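/- Let $q\in\mathbb C$ satisfy $q^n\neq 1$ for all $n\ge 1$, and write $(x;q)_n:=\prod_{i=1}^n(1-xq^{i-1})$. For $i,j,k,l\in\mathbb Z_{\ge 0}$ and parameters $t,s$ define the stochastic $q$-Hahn vertex weight (with incoming labels $i$ at the bottom and $j$ on the left, and outgoing labels $k$ at the top and $l$ on the right) $$W^{\sf s}_{t,s}(i,j;k,l):=\mathbf 1_{i+j=k+l}\,\mathbf 1_{i\ge l}\; s^{2l}t^{-2l}\,\frac{(s^2/t^2;q)_{i-l}(t^2;q)_l}{(s^2;q)_i}\,\frac{(q;q)_i}{(q;q)_{i-l}(q;q)_l}.$$ Then for all $a_1,a_2,a_3,b_1,b_2,b_3\in\mathbb Z_{\ge 0}$ the following equality of rational functions holds in the field $\mathbb C(t_1,t_2,t_3,\eta)$: $$\sum_{l_1,l_2,l_3\ge 0} W^{\sf s}_{\eta t_2,\eta t_3}(a_3,a_2;l_3,l_2)\,W^{\sf s}_{t_1,t_3}(l_3,a_1;b_3,l_1)\,W^{\sf s}_{\eta t_1,\eta t_2}(l_2,l_1;b_2,b_1)$$ $$=\sum_{l_1,l_2,l_3\ge 0}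 W^{\sf s}_{t_1,t_2}(a_2,a_1;l_2,l_1)\,W^{\sf s}_{\eta t_1,\eta t_3}(a_3,l_1;l_3,b_1)\,W^{\sf s}_{t_2,t_3}(l_3,l_2;b_3,b_2),$$ where each of the two sums has only finitely many nonzero terms. -/

import Mathlib

noncomputable section

/-- The `q`-Pochhammer symbol `(x;q)_n = ∏_{i=1}^n (1 - x q^{i-1})`. -/
def qPoch {K : Type*} [Field K] (q x : K) (n : ℕ) : K :=
  ∏ i ∈ Finset.range n, (1 - x * q ^ i)

/-- The stochastic `q`-Hahn vertex weight `W_{t,s}(i,j;k,l)`, where `i` (bottom) and `j` (left)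
are the incoming labels and `k` (top) and `l` (right) are the outgoing labels. -/
def qHahnWeight {K : Type*} [Field K] (q t s : K) (i j k l : ℕ) : K :=
  if i + j = k + l ∧ l ≤ i then
    s ^ (2 * l) / t ^ (2 * l)
      * (qPoch q (s ^ 2 / t ^ 2) (i - l) * qPoch q (t ^ 2) l / qPoch q (s ^ 2) i)
      * (qPoch q q i / (qPoch q q (i - l) * qPoch q q l))
  else 0

/-- The field `ℂ(t₁, t₂, t₃, η)` of rational functions in four variables. -/
abbrev RatFun4 : Type := FractionRing (MvPolynomial (Fin 4) ℂ)

namespace RatFun4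

/-- A complex number regarded as a constant rational function. -/
def const (c : ℂ) : RatFun4 :=
  algebraMap (MvPolynomial (Fin 4) ℂ) RatFun4 (MvPolynomial.C c)

/-- The variable `t₁`. -/
def t₁ : RatFun4 := algebraMap (MvPolynomial (Fin 4) ℂ) RatFun4 (MvPolynomial.X 0)

/-- The variable `t₂`. -/
def t₂ : RatFun4 := algebraMap (MvPolynomial (Fin 4) ℂ) RatFun4 (MvPolynomial.X 1)

/-- The variable `t₃`. -/
def t₃ : RatFun4 := algebraMap (MvPolynomial (Fin 4) ℂ) RatFun4 (MvPolynomial.X 2)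

/-- The variable `η`. -/
def η : RatFun4 := algebraMap (MvPolynomial (Fin 4) ℂ) RatFun4 (MvPolynomial.X 3)

/-- The `q`-Hahn weight with complex quantization parameter `q` and parameters `t, s` in
`ℂ(t₁, t₂, t₃, η)`. -/
def W (q : ℂ) (t s : RatFun4) (i j k l : ℕ) : RatFun4 :=
  qHahnWeight (const q) t s i j k l

end RatFun4

end

/-! Put `X = t₁⁻²`, `Y = t₂⁻²`, `Z = t₃⁻²`, `h = η²`. After homogenising the Pochhammer symbols,
each weight becomes a `qHahnSplit` coefficient, with third parameter `h` for the weights carrying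
`η` and `1` for the others.

These coefficients are connection coefficients. If `A N = q N A` and `L(Y) = A + Y N`, then `L(Y)^n`
expands in the products `L(Z)^m L(X)^(n-m)` with coefficients `qHahnSplit q X Y Z n m`
(`qBracket_smul_pencil_pow`). In a concrete representation on sequences, `L(1)` fixes `e₀`, so
`L(X)^a e₀` expands in the vectors `L(Y)^m e₀` with third parameter `1`.

Now expand `L(Y)^n L(X)^a e₀` in the independent vectors `L(Z)^b e₀` in two ways: rewrite `L(Y)^n`
through `Z` and `X` first, or rewrite `L(X)^a e₀` through `Y` first. Equating coefficients gives
`qHahnSplit_exchange`. The full equation reduces to it because the two `η`-weights on the left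
factor as the single `η`-weight on the right times a split free of `h`
(`qHahnSplit_mul_qHahnSplit`). -/

/-- The Gaussian binomial coefficient, defined by the `q`-Pascal recursion. -/
def gaussBinom {K : Type*} [CommRing K] (q : K) : ℕ → ℕ → K
  | _, 0 => 1
  | 0, _ + 1 => 0
  | n + 1, k + 1 => gaussBinom q n k + q ^ (k + 1) * gaussBinom q n (k + 1)

/-- The homogeneous `q`-shifted factorial `∏_{i<n} (a - b q^i)`. -/
def qBracket {K : Type*} [CommRing K] (q a b : K) (n : ℕ) : K :=
  ∏ i ∈ Finset.range n, (a - b * q ^ i)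

/-! ### Gaussian binomials and homogeneous shifted factorials. -/

section CommRing

variable {K : Type*} [CommRing K] (q : K)

@[simp]
theorem gaussBinom_zero_right (n : ℕ) : gaussBinom q n 0 = 1 := by
  cases n <;> rfl

theorem gaussBinom_succ_succ (n k : ℕ) :
    gaussBinom q (n + 1) (k + 1) = gaussBinom q n k + q ^ (k + 1) * gaussBinom q n (k + 1) :=
  rfl

theorem gaussBinom_eq_zero_of_lt {n k : ℕ} (h : n < k) : gaussBinom q n k = 0 := by
  induction n generalizing k with
  | zero => obtain ⟨k, rfl⟩ := Nat.exists_eq_succ_of_ne_zero h.ne'; rfl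
  | succ n ih =>
    obtain ⟨k, rfl⟩ := Nat.exists_eq_succ_of_ne_zero (Nat.ne_zero_of_lt h)
    rw [gaussBinom_succ_succ, ih (by omega), ih (by omega)]
    ring

@[simp]
theorem gaussBinom_self (n : ℕ) : gaussBinom q n n = 1 := by
  induction n with
  | zero => rfl
  | succ n ih =>
    rw [gaussBinom_succ_succ, ih, gaussBinom_eq_zero_of_lt q (Nat.lt_succ_self n)]
    ring

theorem gaussBinom_succ_succ' {n k : ℕ} (h : k ≤ n) :
    gaussBinom q (n + 1) (k + 1) = q ^ (n - k) * gaussBinom q n k + gaussBinom q n (k + 1) := by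
  induction n generalizing k with
  | zero =>
    obtain rfl : k = 0 := by omega
    simp [gaussBinom]
  | succ n ih =>
    cases k with
    | zero =>
      have h1 := ih (Nat.zero_le n)
      have h2 := gaussBinom_succ_succ q n 0
      rw [gaussBinom_succ_succ q (n + 1) 0]
      simp only [gaussBinom_zero_right, Nat.sub_zero] at *
      linear_combination q * h1 - h2
    | succ k =>
      rcases Nat.lt_or_ge k n with hk | hk
      · have h1 := ih (show k ≤ n by omega)
        have h2 := ih (show k + 1 ≤ n by omega)
        have h3 := gaussBinom_succ_succ q n k
        have h4 := gaussBinom_succ_succ q n (k + 1)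
        obtain ⟨d, rfl⟩ : ∃ d, n = k + 1 + d := ⟨n - (k + 1), by omega⟩
        rw [gaussBinom_succ_succ q (k + 1 + d + 1) (k + 1)]
        rw [show k + 1 + d - k = d + 1 by omega] at h1
        rw [show k + 1 + d - (k + 1) = d by omega] at h2
        rw [show k + 1 + d + 1 - (k + 1) = d + 1 by omega]
        linear_combination h1 + q ^ (k + 2) * h2 - q ^ (d + 1) * h3 - h4
      · obtain rfl : k = n := by omega
        simp [gaussBinom_eq_zero_of_lt]

/-- The factorial formula with denominators cleared, so that it holds in any commutative ring. -/
theorem gaussBinom_add_mul (j k : ℕ) :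
    gaussBinom q (j + k) k * (qBracket q 1 q j * qBracket q 1 q k) = qBracket q 1 q (j + k) := by
  induction k generalizing j with
  | zero => simp [qBracket]
  | succ k ihk =>
    induction j with
    | zero => simp [qBracket]
    | succ j ihj =>
      have h1 := ihk (j + 1)
      rw [show j + 1 + (k + 1) = j + 1 + k + 1 by ring, gaussBinom_succ_succ]
      rw [show j + (k + 1) = j + 1 + k by ring] at ihj
      simp only [qBracket, Finset.prod_range_succ] at *
      linear_combination (1 - q * q ^ k) * h1 + q ^ (k + 1) * (1 - q * q ^ j) * ihj

@[simp]
theorem qBracket_zero (a b : K) : qBracket q a b 0 = 1 := rfl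

theorem qBracket_succ (a b : K) (n : ℕ) :
    qBracket q a b (n + 1) = qBracket q a b n * (a - b * q ^ n) :=
  Finset.prod_range_succ _ _

theorem qBracket_succ' (a b : K) (n : ℕ) :
    qBracket q a b (n + 1) = (a - b) * qBracket q a (q * b) n := by
  rw [qBracket, Finset.prod_range_succ', mul_comm]
  simp only [qBracket, pow_zero, mul_one]
  congr 1
  exact Finset.prod_congr rfl fun i _ => by ring

end CommRing

/-! ### Powers in a `q`-commuting pencil. -/

section Pencil

variable {K R : Type*} [CommRing K] [Ring R] [Algebra K R] {q : K} {A N : R}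

/-- With `N` moved to the left of `A`, the product is `A² + q(X + Y) N A + qXY N²`, symmetric in `X`
and `Y`. -/
theorem pencil_mul_swap (h : A * N = q • (N * A)) (X Y : K) :
    (A + (q * X) • N) * (A + Y • N) = (A + (q * Y) • N) * (A + X • N) := by
  simp only [mul_add, add_mul, mul_smul_comm, smul_mul_assoc, h]
  module

theorem pencil_pow_mul_swap (h : A * N = q • (N * A)) (X Y : K) (p : ℕ) :
    (A + (q * X) • N) ^ p * (A + Y • N) = (A + (Y * q ^ p) • N) * (A + X • N) ^ p := by
  induction p with
  | zero => simp
  | succ p ih =>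
    rw [pow_succ', mul_assoc, ih, ← mul_assoc, pencil_mul_swap h, mul_assoc, ← pow_succ',
      show q * (Y * q ^ p) = Y * q ^ (p + 1) by ring]

/-- Expansion of a power of a member of a `q`-commuting pencil in two other members. -/
theorem qBracket_smul_pencil_pow (h : A * N = q • (N * A)) (X Y Z : K) (n : ℕ) :
    qBracket q Z X n • (A + Y • N) ^ n =
      ∑ m ∈ Finset.range (n + 1),
        (gaussBinom q n m * qBracket q Z Y (n - m) * qBracket q Y X m) •
          ((A + Z • N) ^ m * (A + X • N) ^ (n - m)) := by
  induction n generalizing X with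
  | zero => simp
  | succ n ih =>
    -- The induction hypothesis is used at `q * X`: peeling `Z - X` off the bracket shifts `X`, and
    -- moving the new factor `A + Y • N` leftwards shifts it back.
    have step : qBracket q Z X (n + 1) • (A + Y • N) ^ (n + 1) =
        ∑ m ∈ Finset.range (n + 1),
          ((gaussBinom q n m * qBracket q Z Y (n + 1 - m) * qBracket q Y (q * X) m) •
            ((A + Z • N) ^ m * (A + X • N) ^ (n + 1 - m)) +
          (gaussBinom q n m * qBracket q Z Y (n - m) * qBracket q Y (q * X) m *
              (Y * q ^ (n - m) - X)) •
            ((A + Z • N) ^ (m + 1) * (A + X • N) ^ (n - m))) := by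
      rw [qBracket_succ', mul_smul, pow_succ, ← smul_mul_assoc, ih, Finset.sum_mul,
        Finset.smul_sum]
      refine Finset.sum_congr rfl fun m hm => ?_
      have hm' : n + 1 - m = n - m + 1 := by have := Finset.mem_range.1 hm; omega
      -- Any member of the pencil interpolates linearly between the members at `X` and `Z`.
      have key : (Z - X) • (A + (Y * q ^ (n - m)) • N) =
          (Z - Y * q ^ (n - m)) • (A + X • N) + (Y * q ^ (n - m) - X) • (A + Z • N) := by
        module
      rw [hm', qBracket_succ, smul_mul_assoc, mul_assoc (_ ^ m), pencil_pow_mul_swap h, smul_comm,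
        ← mul_smul_comm, ← smul_mul_assoc (Z - X), key, add_mul, mul_add, smul_mul_assoc,
        smul_mul_assoc, mul_smul_comm, mul_smul_comm, smul_add, smul_smul,
        smul_smul, ← pow_succ', ← mul_assoc, ← pow_succ]
      congr 2
      ring
    rw [step, Finset.sum_add_distrib]
    have ext0 : ∑ m ∈ Finset.range (n + 1),
          (gaussBinom q n m * qBracket q Z Y (n + 1 - m) * qBracket q Y (q * X) m) •
            ((A + Z • N) ^ m * (A + X • N) ^ (n + 1 - m)) =
        ∑ m ∈ Finset.range (n + 1 + 1),
          (gaussBinom q n m * qBracket q Z Y (n + 1 - m) * qBracket q Y (q * X) m) •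
            ((A + Z • N) ^ m * (A + X • N) ^ (n + 1 - m)) := by
      rw [Finset.sum_range_succ _ (n + 1), gaussBinom_eq_zero_of_lt q (Nat.lt_succ_self n)]
      simp
    rw [ext0, Finset.sum_range_succ', Finset.sum_range_succ' _ (n + 1), add_right_comm,
      ← Finset.sum_add_distrib]
    congr 1
    · refine Finset.sum_congr rfl fun m hm => ?_
      have hm : m ≤ n := by have := Finset.mem_range.1 hm; omega
      rw [Nat.add_sub_add_right, ← add_smul]
      congr 1
      -- The parts carrying `Y` and `X` recombine by the two different `q`-Pascal rules.
      rw [qBracket_succ q Y (q * X), qBracket_succ' q Y X]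
      linear_combination (-(Y * qBracket q Z Y (n - m) * qBracket q Y (q * X) m)) *
          gaussBinom_succ_succ' q hm +
        X * qBracket q Z Y (n - m) * qBracket q Y (q * X) m * gaussBinom_succ_succ q n m
    · simp

end Pencil

/-! ### A representation of the pencil on sequences. -/

section Sequences

variable {K : Type*} [CommRing K] (q : K)

/-- The right shift on sequences. -/
def seqShift : Module.End K (ℕ → K) where
  toFun g
    | 0 => 0
    | k + 1 => g k
  map_add' f g := by ext (_ | k) <;> simp
  map_smul' c g := by ext (_ | k) <;> simp

/-- The operator `g ↦ (1 - shift) (q ^ k g k)` on sequences. -/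
def seqDilate : Module.End K (ℕ → K) where
  toFun g
    | 0 => g 0
    | k + 1 => q ^ (k + 1) * g (k + 1) - q ^ k * g k
  map_add' f g := by ext (_ | k) <;> simp; ring
  map_smul' c g := by ext (_ | k) <;> simp; ring

/-- The pencil spanned by `seqDilate` and `seqShift`. -/
def seqPencil (Y : K) : Module.End K (ℕ → K) := seqDilate q + Y • seqShift

theorem seqPencil_apply_zero (Y : K) (g : ℕ → K) : seqPencil q Y g 0 = g 0 := by
  simp [seqPencil, seqDilate, seqShift]

theorem seqPencil_apply_succ (Y : K) (g : ℕ → K) (k : ℕ) :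
    seqPencil q Y g (k + 1) = q ^ (k + 1) * g (k + 1) + (Y - q ^ k) * g k := by
  simp [seqPencil, seqDilate, seqShift]
  ring

/-- On generating functions the operators are `f(x) ↦ (1 - x) f(qx)` and `f(x) ↦ x f(x)`; dilating
the factor `x` produces the `q`. -/
theorem seqDilate_mul_seqShift :
    seqDilate q * seqShift = q • (seqShift * seqDilate q : Module.End K (ℕ → K)) := by
  ext g k
  rcases k with _ | _ | k
  · simp [seqDilate, seqShift]
  · simp [seqDilate, seqShift]
  · simp [seqDilate, seqShift]
    ring

/-- The sequence `k ↦ ∏_{i<k} (Y - q^i) * [a choose k]_q`. -/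
def weightedBinom (Y : K) (a k : ℕ) : K := qBracket q Y 1 k * gaussBinom q a k

theorem seqPencil_weightedBinom (Y : K) (a : ℕ) :
    seqPencil q Y (weightedBinom q Y a) = weightedBinom q Y (a + 1) := by
  ext (_ | k)
  · simp [seqPencil_apply_zero, weightedBinom]
  · rw [seqPencil_apply_succ]
    simp only [weightedBinom, gaussBinom_succ_succ, qBracket_succ]
    ring

theorem seqPencil_pow_weightedBinom (Y : K) (a n : ℕ) :
    (seqPencil q Y ^ n) (weightedBinom q Y a) = weightedBinom q Y (n + a) := by
  induction n with
  | zero => simp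
  | succ n ih =>
    rw [pow_succ', Module.End.mul_apply, ih, seqPencil_weightedBinom, Nat.succ_add_eq_add_succ]
    rfl

theorem weightedBinom_zero (Y : K) : weightedBinom q Y 0 = Pi.single 0 1 := by
  ext (_ | k)
  · simp [weightedBinom]
  · simp [weightedBinom, gaussBinom_eq_zero_of_lt q (Nat.succ_pos k)]

/-- The vector is `e₀`, and its image at index `1` has coefficient `Y - q^0`, which vanishes at `Y =
1`. This is the source of the third parameter `1`. -/
theorem seqPencil_one_pow_weightedBinom_zero (Y : K) (n : ℕ) :
    (seqPencil q 1 ^ n) (weightedBinom q Y 0) = weightedBinom q Y 0 := by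
  have h : seqPencil q 1 (weightedBinom q Y 0) = weightedBinom q Y 0 := by
    rw [weightedBinom_zero]
    ext (_ | _ | k)
    · simp [seqPencil_apply_zero]
    · simp [seqPencil_apply_succ]
    · simp [seqPencil_apply_succ]
  induction n with
  | zero => rfl
  | succ n ih => rw [pow_succ, Module.End.mul_apply, h, ih]

/-- The vectors are triangular: the one of index `b` vanishes beyond `b` and has entry `qBracket q Z
1 b` there. -/
theorem eq_zero_of_sum_smul_weightedBinom {F : Type*} [Field F] {q Z : F}
    (hZ : ∀ n, qBracket q Z 1 n ≠ 0) (c : ℕ → F) (M : ℕ)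
    (h : ∑ b ∈ Finset.range M, c b • weightedBinom q Z b = 0) : ∀ b < M, c b = 0 := by
  induction M with
  | zero => simp
  | succ M ih =>
    have top : c M = 0 := by
      have h1 := congrFun h M
      rw [Finset.sum_range_succ, Pi.add_apply, Finset.sum_apply, Finset.sum_eq_zero] at h1
      · simpa [weightedBinom, hZ M] using h1
      · intro b hb
        simp [weightedBinom, gaussBinom_eq_zero_of_lt q (Finset.mem_range.1 hb)]
    rw [Finset.sum_range_succ, top, zero_smul, add_zero] at h
    intro b hb
    rcases Nat.lt_succ_iff_lt_or_eq.1 hb with hb | rfl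
    · exact ih h b hb
    · exact top

end Sequences

/-! ### Splitting weights and the reduced exchange identity. -/

section Field

variable {F : Type*} [Field F] {q : F}

/-- The `q`-Hahn splitting weight in the homogeneous parametrization. -/
def qHahnSplit (q h X Y : F) (i l : ℕ) : F :=
  gaussBinom q i l * qBracket q Y X (i - l) * qBracket q X h l / qBracket q Y h i

theorem qHahnSplit_eq_zero_of_lt (h X Y : F) {i l : ℕ} (hil : i < l) :
    qHahnSplit q h X Y i l = 0 := by
  simp [qHahnSplit, gaussBinom_eq_zero_of_lt q hil]

theorem seqPencil_pow_eq_sum {X Z : F} (n : ℕ) (hZX : qBracket q Z X n ≠ 0) (Y : F) :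
    seqPencil q Y ^ n = ∑ m ∈ Finset.range (n + 1),
      qHahnSplit q X Y Z n m • (seqPencil q Z ^ m * seqPencil q X ^ (n - m)) := by
  have h := qBracket_smul_pencil_pow (seqDilate_mul_seqShift q) X Y Z n
  rw [← inv_smul_smul₀ hZX (seqPencil q Y ^ n), seqPencil, h, Finset.smul_sum]
  refine Finset.sum_congr rfl fun m _ => ?_
  rw [smul_smul, qHahnSplit, div_eq_inv_mul]
  rfl

theorem weightedBinom_eq_sum {Y : F} (hY : ∀ n, qBracket q Y 1 n ≠ 0) (X : F) (a : ℕ) :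
    weightedBinom q X a =
      ∑ m ∈ Finset.range (a + 1), qHahnSplit q 1 X Y a m • weightedBinom q Y m := by
  have h := congrArg (fun T => T (weightedBinom q X 0)) (seqPencil_pow_eq_sum a (hY a) X)
  simp only [LinearMap.sum_apply, LinearMap.smul_apply, Module.End.mul_apply,
    seqPencil_one_pow_weightedBinom_zero] at h
  rw [seqPencil_pow_weightedBinom] at h
  simp only [weightedBinom_zero q X, ← weightedBinom_zero q Y] at h
  simpa only [seqPencil_pow_weightedBinom, add_zero] using h

/-- The reduced Yang–Baxter identity for the splitting weights. -/
theorem qHahnSplit_exchange {X Y Z : F} (hY : ∀ n, qBracket q Y 1 n ≠ 0)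
    (hZ : ∀ n, qBracket q Z 1 n ≠ 0) (hZX : ∀ n, qBracket q Z X n ≠ 0) (n a b : ℕ) :
    ∑ m ∈ (Finset.range (n + 1)).filter (· ≤ b),
        qHahnSplit q X Y Z n m * qHahnSplit q 1 X Z (n - m + a) (b - m) =
      ∑ l ∈ Finset.range (a + 1), qHahnSplit q 1 X Y a l * qHahnSplit q 1 Y Z (n + l) b := by
  -- Padding with zero terms lets both expansions run over the common range `n + a + b + 1`, long
  -- enough to contain the index `b` being compared.
  have expand (X : F) (s M : ℕ) (hM : s < M) : weightedBinom q X s =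
      ∑ m ∈ Finset.range M, qHahnSplit q 1 X Z s m • weightedBinom q Z m := by
    rw [weightedBinom_eq_sum hZ]
    refine Finset.sum_subset (Finset.range_subset_range.2 hM) fun m _ hm => ?_
    rw [qHahnSplit_eq_zero_of_lt, zero_smul]
    simpa using hm
  have left : (seqPencil q Y ^ n) (weightedBinom q X a) =
      ∑ b ∈ Finset.range (n + a + b + 1),
        (∑ m ∈ (Finset.range (n + 1)).filter (· ≤ b),
          qHahnSplit q X Y Z n m * qHahnSplit q 1 X Z (n - m + a) (b - m)) •
            weightedBinom q Z b := by
    simp only [seqPencil_pow_eq_sum n (hZX n) Y, LinearMap.sum_apply, LinearMap.smul_apply,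
      Module.End.mul_apply, seqPencil_pow_weightedBinom, Finset.sum_smul]
    simp only [Finset.sum_filter]
    rw [Finset.sum_comm]
    refine Finset.sum_congr rfl fun m hm => ?_
    have hm : m ≤ n := by have := Finset.mem_range.1 hm; omega
    rw [expand X (n - m + a) (n + a + b + 1 - m) (by omega), map_sum, Finset.smul_sum,
      ← Finset.sum_filter]
    refine Finset.sum_bij' (fun c _ => m + c) (fun c _ => c - m) ?_ ?_ ?_ ?_ ?_
    · intro c hc
      simp only [Finset.mem_range, Finset.mem_filter] at *
      omega
    · intro c hc
      simp only [Finset.mem_range, Finset.mem_filter] at *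
      omega
    · intro c _
      simp
    · intro c hc
      simp only [Finset.mem_range, Finset.mem_filter] at *
      omega
    · intro c _
      rw [map_smul, seqPencil_pow_weightedBinom, smul_smul, Nat.add_sub_cancel_left]
  have right : (seqPencil q Y ^ n) (weightedBinom q X a) =
      ∑ b ∈ Finset.range (n + a + b + 1),
        (∑ l ∈ Finset.range (a + 1), qHahnSplit q 1 X Y a l * qHahnSplit q 1 Y Z (n + l) b) •
            weightedBinom q Z b := by
    rw [weightedBinom_eq_sum hY, map_sum]
    simp only [Finset.sum_smul]
    rw [Finset.sum_comm]
    refine Finset.sum_congr rfl fun l hl => ?_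
    have hl : l ≤ a := by have := Finset.mem_range.1 hl; omega
    rw [map_smul, seqPencil_pow_weightedBinom, expand Y (n + l) (n + a + b + 1) (by omega),
      Finset.smul_sum]
    simp only [smul_smul]
  refine sub_eq_zero.1 (eq_zero_of_sum_smul_weightedBinom hZ
    (fun b => ∑ m ∈ (Finset.range (n + 1)).filter (· ≤ b),
        qHahnSplit q X Y Z n m * qHahnSplit q 1 X Z (n - m + a) (b - m) -
      ∑ l ∈ Finset.range (a + 1), qHahnSplit q 1 X Y a l * qHahnSplit q 1 Y Z (n + l) b)
    (n + a + b + 1) ?_ b (by omega))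
  simp only [sub_smul]
  rw [Finset.sum_sub_distrib, ← left, ← right, sub_self]

theorem qBracket_one_ne_zero (hq : ∀ n : ℕ, 1 ≤ n → q ^ n ≠ 1) (n : ℕ) :
    qBracket q 1 q n ≠ 0 :=
  Finset.prod_ne_zero_iff.2 fun i _ h =>
    hq (i + 1) (by omega) (by rw [pow_succ']; exact (sub_eq_zero.1 h).symm)

theorem gaussBinom_mul_gaussBinom (hq : ∀ n : ℕ, 1 ≤ n → q ^ n ≠ 1) {b m n : ℕ} (h : m ≤ n) :
    gaussBinom q (b + n) (b + m) * gaussBinom q (b + m) b =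
      gaussBinom q (b + n) b * gaussBinom q n m := by
  obtain ⟨d, rfl⟩ := Nat.exists_eq_add_of_le h
  have h1 := gaussBinom_add_mul q d (b + m)
  have h2 := gaussBinom_add_mul q m b
  have h3 := gaussBinom_add_mul q (m + d) b
  have h4 := gaussBinom_add_mul q d m
  rw [show d + (b + m) = b + (m + d) by ring] at h1
  rw [show m + d + b = b + (m + d) by ring] at h3
  rw [add_comm m b] at h2
  rw [add_comm d m] at h4
  have nz := qBracket_one_ne_zero hq
  refine mul_right_cancel₀ (mul_ne_zero (mul_ne_zero (nz d) (nz m)) (nz b)) ?_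
  linear_combination gaussBinom q (b + (m + d)) (b + m) * qBracket q 1 q d * h2 + h1 -
    gaussBinom q (b + (m + d)) b * qBracket q 1 q b * h4 - h3

/-- Splitting in two stages with parameters `(Y, Z)` and `(X, Y)` factors through a single split
with parameters `(X, Z)`. -/
theorem qHahnSplit_mul_qHahnSplit (hq : ∀ n : ℕ, 1 ≤ n → q ^ n ≠ 1) {h X Y Z : F}
    (hY : ∀ n, qBracket q Y h n ≠ 0) (hZX : ∀ n, qBracket q Z X n ≠ 0) {b m n : ℕ}
    (hmn : m ≤ n) :
    qHahnSplit q h Y Z (b + n) (b + m) * qHahnSplit q h X Y (b + m) b =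
      qHahnSplit q h X Z (b + n) b * qHahnSplit q X Y Z n m := by
  simp only [qHahnSplit, Nat.add_sub_add_left, Nat.add_sub_cancel_left]
  have := gaussBinom_mul_gaussBinom hq (b := b) hmn
  have h1 := hY (b + m)
  have h2 := hZX n
  -- Only `qBracket q Y h (b + m)` and `qBracket q Z X n` must be cancelled; the denominator
  -- `qBracket q Z h (b + n)` is common to both sides and may vanish.
  calc _ = (gaussBinom q (b + n) (b + m) * gaussBinom q (b + m) b) * qBracket q Z Y (n - m) *
        qBracket q Y X m * qBracket q X h b / qBracket q Z h (b + n) *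
        (qBracket q Y h (b + m) / qBracket q Y h (b + m)) := by ring
    _ = (gaussBinom q (b + n) b * gaussBinom q n m) * qBracket q Z Y (n - m) *
        qBracket q Y X m * qBracket q X h b / qBracket q Z h (b + n) *
        (qBracket q Z X n / qBracket q Z X n) := by rw [this, div_self h1, div_self h2]
    _ = _ := by ring

theorem qPoch_div {a : F} (ha : a ≠ 0) (b : F) (n : ℕ) :
    qPoch q (b / a) n = qBracket q a b n / a ^ n := by
  induction n with
  | zero => simp [qPoch]
  | succ n ih =>
    rw [qPoch, Finset.prod_range_succ, ← qPoch, ih, qBracket_succ, pow_succ]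
    field_simp

theorem gaussBinom_eq_qPoch (hq : ∀ n : ℕ, 1 ≤ n → q ^ n ≠ 1) {i l : ℕ} (h : l ≤ i) :
    gaussBinom q i l = qPoch q q i / (qPoch q q (i - l) * qPoch q q l) := by
  obtain ⟨d, rfl⟩ := Nat.exists_eq_add_of_le' h
  have nz : ∀ n, qPoch q q n ≠ 0 := qBracket_one_ne_zero hq
  rw [Nat.add_sub_cancel, eq_div_iff (mul_ne_zero (nz d) (nz l))]
  exact gaussBinom_add_mul q d l

/-- Homogenising leaves the powers `t^(2l) s^(2(i-l)) / s^(2i)`, which cancel the prefactor. The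
guard `l ≤ i` is absorbed by the vanishing of the Gaussian binomial. -/
theorem qHahnWeight_eq_qHahnSplit (hq : ∀ n : ℕ, 1 ≤ n → q ^ n ≠ 1) {h t s : F} (h0 : h ≠ 0)
    (ht : t ≠ 0) (hs : s ≠ 0) (i j k l : ℕ) :
    qHahnWeight q (h * t) (h * s) i j k l =
      if i + j = k + l then
        qHahnSplit q (h ^ 2) (t ^ 2)⁻¹ (s ^ 2)⁻¹ i l else 0 := by
  by_cases hc : i + j = k + l
  swap
  · simp [qHahnWeight, hc]
  rcases Nat.lt_or_ge i l with hl | hl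
  · simp [qHahnWeight, hc, qHahnSplit_eq_zero_of_lt, hl]
  rw [qHahnWeight, if_pos ⟨hc, hl⟩, if_pos hc, ← gaussBinom_eq_qPoch hq hl, qHahnSplit]
  have hs2 : (s ^ 2)⁻¹ ≠ 0 := inv_ne_zero (pow_ne_zero 2 hs)
  have ht2 : (t ^ 2)⁻¹ ≠ 0 := inv_ne_zero (pow_ne_zero 2 ht)
  rw [show (h * s) ^ 2 / (h * t) ^ 2 = (t ^ 2)⁻¹ / (s ^ 2)⁻¹ by field_simp,
    show (h * t) ^ 2 = h ^ 2 / (t ^ 2)⁻¹ by field_simp,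
    show (h * s) ^ 2 = h ^ 2 / (s ^ 2)⁻¹ by field_simp, qPoch_div hs2, qPoch_div ht2, qPoch_div hs2]
  obtain ⟨d, rfl⟩ := Nat.exists_eq_add_of_le' hl
  rw [Nat.add_sub_cancel]
  generalize qBracket q (s ^ 2)⁻¹ (t ^ 2)⁻¹ d = u, qBracket q (t ^ 2)⁻¹ (h ^ 2) l = v,
    qBracket q (s ^ 2)⁻¹ (h ^ 2) (d + l) = w
  simp only [pow_mul, mul_pow, pow_add, inv_pow]
  field_simp

end Field

/-! ### Reduction to finite sums and the Yang–Baxter equation for splits. -/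

theorem finsum_finsum_finsum_eq_sum {F : Type*} [AddCommMonoid F] (f : ℕ → ℕ → ℕ → F) (M : ℕ)
    (h : ∀ a b c, f a b c ≠ 0 → a < M ∧ b < M ∧ c < M) :
    ∑ᶠ (a : ℕ) (b : ℕ) (c : ℕ), f a b c =
      ∑ p ∈ Finset.range M ×ˢ Finset.range M ×ˢ Finset.range M, f p.1 p.2.1 p.2.2 := by
  have key (g : ℕ → F) (hg : ∀ a, g a ≠ 0 → a < M) : ∑ᶠ a, g a = ∑ a ∈ Finset.range M, g a :=
    finsum_eq_sum_of_support_subset _ fun a ha => by simpa using hg a ha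
  have h3 (a b : ℕ) : ∑ᶠ c, f a b c = ∑ c ∈ Finset.range M, f a b c :=
    key _ fun c hc => (h a b c hc).2.2
  have h2 (a : ℕ) : ∑ᶠ (b : ℕ) (c : ℕ), f a b c =
      ∑ b ∈ Finset.range M, ∑ c ∈ Finset.range M, f a b c := by
    simp only [h3]
    refine key _ fun b hb => ?_
    obtain ⟨c, -, hc⟩ := Finset.exists_ne_zero_of_sum_ne_zero hb
    exact (h a b c hc).2.1
  simp only [h2, Finset.sum_product]
  refine key _ fun a ha => ?_
  obtain ⟨b, -, hb⟩ := Finset.exists_ne_zero_of_sum_ne_zero ha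
  obtain ⟨c, -, hc⟩ := Finset.exists_ne_zero_of_sum_ne_zero hb
  exact (h a b c hc).1

theorem finite_of_ne_zero_lt {F : Type*} [Zero F] (f : ℕ → ℕ → ℕ → F) (M : ℕ)
    (h : ∀ a b c, f a b c ≠ 0 → a < M ∧ b < M ∧ c < M) :
    {p : ℕ × ℕ × ℕ | f p.1 p.2.1 p.2.2 ≠ 0}.Finite :=
  ((Set.finite_Iio M).prod ((Set.finite_Iio M).prod (Set.finite_Iio M))).subset
    fun p hp => h p.1 p.2.1 p.2.2 hp

section Field

variable {F : Type*} [Field F] {q : F}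

theorem qHahnSplit_ne_zero {h X Y : F} {i l : ℕ} (hne : qHahnSplit q h X Y i l ≠ 0) : l ≤ i :=
  not_lt.1 fun hil => hne (qHahnSplit_eq_zero_of_lt h X Y hil)

/-- The Yang–Baxter equation for the splitting weights, with the sums over a finite box. -/
theorem sum_qHahnSplit_yangBaxter (hq : ∀ n : ℕ, 1 ≤ n → q ^ n ≠ 1) {h X Y Z : F}
    (hYh : ∀ n, qBracket q Y h n ≠ 0) (hY : ∀ n, qBracket q Y 1 n ≠ 0)
    (hZ : ∀ n, qBracket q Z 1 n ≠ 0) (hZX : ∀ n, qBracket q Z X n ≠ 0)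
    (a₁ a₂ a₃ b₁ b₂ b₃ M : ℕ) (hM : a₁ + a₂ + a₃ < M) :
    ∑ p ∈ Finset.range M ×ˢ Finset.range M ×ˢ Finset.range M,
        (if a₃ + a₂ = p.2.2 + p.2.1 then qHahnSplit q h Y Z a₃ p.2.1 else 0) *
        (if p.2.2 + a₁ = b₃ + p.1 then qHahnSplit q 1 X Z p.2.2 p.1 else 0) *
        (if p.2.1 + p.1 = b₂ + b₁ then qHahnSplit q h X Y p.2.1 b₁ else 0) =
      ∑ p ∈ Finset.range M ×ˢ Finset.range M ×ˢ Finset.range M,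
        (if a₂ + a₁ = p.2.1 + p.1 then qHahnSplit q 1 X Y a₂ p.1 else 0) *
        (if a₃ + p.1 = p.2.2 + b₁ then qHahnSplit q h X Z a₃ b₁ else 0) *
        (if p.2.2 + p.2.1 = b₃ + b₂ then qHahnSplit q 1 Y Z p.2.2 b₂ else 0) := by
  by_cases hc : a₁ + a₂ + a₃ = b₁ + b₂ + b₃
  swap
  · rw [Finset.sum_eq_zero, Finset.sum_eq_zero]
    · rintro ⟨l₁, l₂, l₃⟩ -
      by_contra hne
      simp only [mul_eq_zero, ite_eq_right_iff, not_or, Classical.not_imp] at hne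
      omega
    · rintro ⟨l₁, l₂, l₃⟩ -
      by_contra hne
      simp only [mul_eq_zero, ite_eq_right_iff, not_or, Classical.not_imp] at hne
      omega
  rcases Nat.lt_or_ge a₃ b₁ with hb | hb
  · rw [Finset.sum_eq_zero, Finset.sum_eq_zero]
    · rintro ⟨l₁, l₂, l₃⟩ -
      simp [qHahnSplit_eq_zero_of_lt h X Z hb]
    · rintro ⟨l₁, l₂, l₃⟩ -
      by_contra hne
      simp only [mul_eq_zero, ite_eq_right_iff, not_or, Classical.not_imp] at hne
      have h1 := qHahnSplit_ne_zero hne.1.1.2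
      have h2 := qHahnSplit_ne_zero hne.2.2
      omega
  obtain ⟨n, rfl⟩ := Nat.exists_eq_add_of_le hb
  have exchange := qHahnSplit_exchange hY hZ hZX n a₂ b₂
  trans qHahnSplit q h X Z (b₁ + n) b₁ *
    ∑ m ∈ (Finset.range (n + 1)).filter (· ≤ b₂),
        qHahnSplit q X Y Z n m * qHahnSplit q 1 X Z (n - m + a₂) (b₂ - m)
  · rw [Finset.mul_sum]
    symm
    -- Conservation at the vertices leaves one free index, `m = l₂ - b₁`; here `n = a₃ - b₁`.
    refine Finset.sum_of_injOn (fun m => (b₂ - m, b₁ + m, n - m + a₂)) ?_ ?_ ?_ ?_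
    · intro m _ m' _ hmm
      simp only [Prod.mk.injEq] at hmm
      omega
    · intro m hm
      simp only [Finset.coe_filter, Finset.mem_range, Set.mem_ofPred_eq, Finset.mem_coe,
        Finset.mem_product] at *
      omega
    · rintro ⟨l₁, l₂, l₃⟩ - hp
      by_contra hne
      simp only [mul_eq_zero, ite_eq_right_iff, not_or, Classical.not_imp] at hne
      have h1 := qHahnSplit_ne_zero hne.1.1.2
      have h2 := qHahnSplit_ne_zero hne.2.2
      refine hp ⟨l₂ - b₁, ?_, ?_⟩
      · simp only [Finset.coe_filter, Finset.mem_range, Set.mem_ofPred_eq]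
        omega
      · simp only [Prod.mk.injEq]
        omega
    · intro m hm
      simp only [Finset.mem_filter, Finset.mem_range] at hm
      dsimp only
      rw [if_pos (by omega), if_pos (by omega), if_pos (by omega), ← mul_assoc,
        ← qHahnSplit_mul_qHahnSplit hq hYh hZX (by omega)]
      ring
  · rw [exchange, Finset.mul_sum]
    refine Finset.sum_of_injOn (fun l => (l, a₂ + a₁ - l, n + l)) ?_ ?_ ?_ ?_
    · intro m _ m' _ hmm
      simp only [Prod.mk.injEq] at hmm
      omega
    · intro m hm
      simp only [Finset.mem_range, Finset.mem_coe, Finset.mem_product] at *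
      omega
    · rintro ⟨l₁, l₂, l₃⟩ - hp
      by_contra hne
      simp only [mul_eq_zero, ite_eq_right_iff, not_or, Classical.not_imp] at hne
      have h1 := qHahnSplit_ne_zero hne.1.1.2
      refine hp ⟨l₁, ?_, ?_⟩
      · simp only [Finset.mem_range, Finset.mem_coe]
        omega
      · simp only [Prod.mk.injEq, true_and]
        omega
    · intro m hm
      simp only [Finset.mem_range] at hm
      dsimp only
      rw [if_pos (by omega), if_pos (by omega), if_pos (by omega)]
      ring

end Field

/-! ### Nonvanishing of the denominators over the rational functions. -/

namespace RatFun4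

open MvPolynomial

theorem algebraMap_ne_of_eval_ne {p r : MvPolynomial (Fin 4) ℂ} (x : Fin 4 → ℂ)
    (h : eval x p ≠ eval x r) :
    algebraMap (MvPolynomial (Fin 4) ℂ) RatFun4 p ≠ algebraMap _ RatFun4 r :=
  fun hpr => h (congrArg (eval x) (IsFractionRing.injective _ RatFun4 hpr))

theorem algebraMap_X_ne_zero (i : Fin 4) :
    algebraMap (MvPolynomial (Fin 4) ℂ) RatFun4 (X i) ≠ 0 := by
  rw [← map_zero (algebraMap (MvPolynomial (Fin 4) ℂ) RatFun4)]
  exact algebraMap_ne_of_eval_ne 1 (by simp)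

theorem const_pow_ne_one {q : ℂ} (hq : ∀ n : ℕ, 1 ≤ n → q ^ n ≠ 1) (n : ℕ) (hn : 1 ≤ n) :
    const q ^ n ≠ 1 := by
  rw [const, ← map_pow, ← map_one (algebraMap (MvPolynomial (Fin 4) ℂ) RatFun4)]
  exact algebraMap_ne_of_eval_ne 0 (by simpa using hq n hn)

/-- A factor `1 / t² - b q^i` vanishes only if `1 = t² b q^i`. -/
theorem qBracket_inv_ne_zero {F : Type*} [Field F] {q t b : F} (ht : t ≠ 0)
    (h : ∀ i : ℕ, t ^ 2 * b * q ^ i ≠ 1) (n : ℕ) : qBracket q (t ^ 2)⁻¹ b n ≠ 0 := by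
  refine Finset.prod_ne_zero_iff.2 fun i _ h0 => h i ?_
  rw [mul_assoc, ← sub_eq_zero.1 h0, mul_inv_cancel₀ (pow_ne_zero 2 ht)]

theorem qBracket_X_one_ne_zero (q : ℂ) (i : Fin 4) (n : ℕ) :
    qBracket (const q) ((algebraMap (MvPolynomial (Fin 4) ℂ) RatFun4 (X i)) ^ 2)⁻¹ 1 n ≠ 0 := by
  refine qBracket_inv_ne_zero (algebraMap_X_ne_zero i) (fun j => ?_) n
  rw [const, mul_one, ← map_pow, ← map_pow, ← map_mul,
    ← map_one (algebraMap (MvPolynomial (Fin 4) ℂ) RatFun4)]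
  exact algebraMap_ne_of_eval_ne 0 (by simp)

theorem qBracket_X_X_ne_zero (q : ℂ) (i k : Fin 4) (n : ℕ) :
    qBracket (const q) ((algebraMap (MvPolynomial (Fin 4) ℂ) RatFun4 (X i)) ^ 2)⁻¹
      ((algebraMap (MvPolynomial (Fin 4) ℂ) RatFun4 (X k)) ^ 2) n ≠ 0 := by
  refine qBracket_inv_ne_zero (algebraMap_X_ne_zero i) (fun j => ?_) n
  rw [const, ← map_pow, ← map_pow, ← map_pow, ← map_mul, ← map_mul,
    ← map_one (algebraMap (MvPolynomial (Fin 4) ℂ) RatFun4)]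
  exact algebraMap_ne_of_eval_ne 0 (by simp)

theorem qBracket_X_inv_ne_zero (q : ℂ) {i k : Fin 4} (hik : k ≠ i) (n : ℕ) :
    qBracket (const q) ((algebraMap (MvPolynomial (Fin 4) ℂ) RatFun4 (X i)) ^ 2)⁻¹
      ((algebraMap (MvPolynomial (Fin 4) ℂ) RatFun4 (X k)) ^ 2)⁻¹ n ≠ 0 := by
  have hk := pow_ne_zero 2 (algebraMap_X_ne_zero k)
  refine qBracket_inv_ne_zero (algebraMap_X_ne_zero i) (fun j h => ?_) n
  rw [mul_right_comm, ← div_eq_mul_inv, div_eq_one_iff_eq hk, const, ← map_pow, ← map_pow,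
    ← map_pow, ← map_mul, ← map_pow] at h
  -- At the point with `X k = 1` and all other variables `0`, the relation `X i ^ 2 * q ^ j = X k ^
  -- 2` would read `0 = 1`.
  exact algebraMap_ne_of_eval_ne (Pi.single k 1) (by simp [hik.symm]) h

theorem W_eq {q : ℂ} (hq : ∀ n : ℕ, 1 ≤ n → q ^ n ≠ 1) {t s : RatFun4} (ht : t ≠ 0)
    (hs : s ≠ 0) (i j k l : ℕ) :
    W q t s i j k l =
      if i + j = k + l then qHahnSplit (const q) 1 (t ^ 2)⁻¹ (s ^ 2)⁻¹ i l else 0 := by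
  simpa only [W, one_mul, one_pow] using
    qHahnWeight_eq_qHahnSplit (const_pow_ne_one hq) one_ne_zero ht hs i j k l

theorem W_eta_eq {q : ℂ} (hq : ∀ n : ℕ, 1 ≤ n → q ^ n ≠ 1) {t s : RatFun4} (ht : t ≠ 0)
    (hs : s ≠ 0) (i j k l : ℕ) :
    W q (η * t) (η * s) i j k l =
      if i + j = k + l then qHahnSplit (const q) (η ^ 2) (t ^ 2)⁻¹ (s ^ 2)⁻¹ i l else 0 :=
  qHahnWeight_eq_qHahnSplit (const_pow_ne_one hq) (algebraMap_X_ne_zero 3) ht hs i j k l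

theorem of_W_ne_zero {q : ℂ} {t s : RatFun4} {i j k l : ℕ} (h : W q t s i j k l ≠ 0) :
    i + j = k + l ∧ l ≤ i := by
  by_contra hc
  exact h (if_neg hc)

end RatFun4

theorem mainTheorem9 (q : ℂ) (hq : ∀ n : ℕ, 1 ≤ n → q ^ n ≠ 1) (a₁ a₂ a₃ b₁ b₂ b₃ : ℕ) :
    {(l₁, l₂, l₃) : ℕ × ℕ × ℕ |
      RatFun4.W q (RatFun4.η * RatFun4.t₂) (RatFun4.η * RatFun4.t₃) a₃ a₂ l₃ l₂
        * RatFun4.W q RatFun4.t₁ RatFun4.t₃ l₃ a₁ b₃ l₁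
        * RatFun4.W q (RatFun4.η * RatFun4.t₁) (RatFun4.η * RatFun4.t₂) l₂ l₁ b₂ b₁ ≠ 0}.Finite ∧
    {(l₁, l₂, l₃) : ℕ × ℕ × ℕ |
      RatFun4.W q RatFun4.t₁ RatFun4.t₂ a₂ a₁ l₂ l₁
        * RatFun4.W q (RatFun4.η * RatFun4.t₁) (RatFun4.η * RatFun4.t₃) a₃ l₁ l₃ b₁
        * RatFun4.W q RatFun4.t₂ RatFun4.t₃ l₃ l₂ b₃ b₂ ≠ 0}.Finite ∧
    ∑ᶠ (l₁ : ℕ) (l₂ : ℕ) (l₃ : ℕ),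
      RatFun4.W q (RatFun4.η * RatFun4.t₂) (RatFun4.η * RatFun4.t₃) a₃ a₂ l₃ l₂
        * RatFun4.W q RatFun4.t₁ RatFun4.t₃ l₃ a₁ b₃ l₁
        * RatFun4.W q (RatFun4.η * RatFun4.t₁) (RatFun4.η * RatFun4.t₂) l₂ l₁ b₂ b₁ =
    ∑ᶠ (l₁ : ℕ) (l₂ : ℕ) (l₃ : ℕ),
      RatFun4.W q RatFun4.t₁ RatFun4.t₂ a₂ a₁ l₂ l₁
        * RatFun4.W q (RatFun4.η * RatFun4.t₁) (RatFun4.η * RatFun4.t₃) a₃ l₁ l₃ b₁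
        * RatFun4.W q RatFun4.t₂ RatFun4.t₃ l₃ l₂ b₃ b₂ := by

  have h1 : RatFun4.t₁ ≠ 0 := RatFun4.algebraMap_X_ne_zero 0
  have h2 : RatFun4.t₂ ≠ 0 := RatFun4.algebraMap_X_ne_zero 1
  have h3 : RatFun4.t₃ ≠ 0 := RatFun4.algebraMap_X_ne_zero 2
  have bound₁ : ∀ l₁ l₂ l₃ : ℕ,
      RatFun4.W q (RatFun4.η * RatFun4.t₂) (RatFun4.η * RatFun4.t₃) a₃ a₂ l₃ l₂
        * RatFun4.W q RatFun4.t₁ RatFun4.t₃ l₃ a₁ b₃ l₁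
        * RatFun4.W q (RatFun4.η * RatFun4.t₁) (RatFun4.η * RatFun4.t₂) l₂ l₁ b₂ b₁ ≠ 0 →
      l₁ < a₁ + a₂ + a₃ + 1 ∧ l₂ < a₁ + a₂ + a₃ + 1 ∧ l₃ < a₁ + a₂ + a₃ + 1 := by
    intro l₁ l₂ l₃ h
    have e1 := RatFun4.of_W_ne_zero (left_ne_zero_of_mul (left_ne_zero_of_mul h))
    have e2 := RatFun4.of_W_ne_zero (right_ne_zero_of_mul (left_ne_zero_of_mul h))
    omega
  have bound₂ : ∀ l₁ l₂ l₃ : ℕ,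
      RatFun4.W q RatFun4.t₁ RatFun4.t₂ a₂ a₁ l₂ l₁
        * RatFun4.W q (RatFun4.η * RatFun4.t₁) (RatFun4.η * RatFun4.t₃) a₃ l₁ l₃ b₁
        * RatFun4.W q RatFun4.t₂ RatFun4.t₃ l₃ l₂ b₃ b₂ ≠ 0 →
      l₁ < a₁ + a₂ + a₃ + 1 ∧ l₂ < a₁ + a₂ + a₃ + 1 ∧ l₃ < a₁ + a₂ + a₃ + 1 := by
    intro l₁ l₂ l₃ h
    have e1 := RatFun4.of_W_ne_zero (left_ne_zero_of_mul (left_ne_zero_of_mul h))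
    have e2 := RatFun4.of_W_ne_zero (right_ne_zero_of_mul (left_ne_zero_of_mul h))
    omega
  refine ⟨finite_of_ne_zero_lt _ _ bound₁, finite_of_ne_zero_lt _ _ bound₂, ?_⟩
  rw [finsum_finsum_finsum_eq_sum _ _ bound₁, finsum_finsum_finsum_eq_sum _ _ bound₂]
  simp only [RatFun4.W_eq hq h1 h2, RatFun4.W_eq hq h1 h3, RatFun4.W_eq hq h2 h3,
    RatFun4.W_eta_eq hq h1 h2, RatFun4.W_eta_eq hq h1 h3, RatFun4.W_eta_eq hq h2 h3]
  exact sum_qHahnSplit_yangBaxter (RatFun4.const_pow_ne_one hq)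
    (RatFun4.qBracket_X_X_ne_zero q 1 3) (RatFun4.qBracket_X_one_ne_zero q 1)
    (RatFun4.qBracket_X_one_ne_zero q 2) (RatFun4.qBracket_X_inv_ne_zero q (by decide))
    a₁ a₂ a₃ b₁ b₂ b₃ _ (Nat.lt_succ_self _)
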